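/- For $\lambda>0$ let $\Phi(\lambda)$ denote a homogeneous Poisson point process in $\mathbb{R}^2$ with density $\lambda$ (the base stations). Given $\Phi(\lambda)$, let $U_Y$, $Y\in\Phi(\lambda)$, be independent points (the active mobiles), $U_Y$ being uniformly distributed in the Voronoi cell of $\Phi(\lambda)$ with nucleus $Y$. Let each $Y$ also carry a label $\xi_Y$ in some measurable space; the labels are i.i.d. with a law $\nu$ that does not depend on $\lambda$, and are independent of all locations. Let $h_Y\in\mathbb{R}$ be a coefficient attached to the station $Y$ by a measurable rule that does not depend on $\lambda$: $h_Y$ is a function of the point $(Y,U_Y,\xi_Y)$ and of the unordered collection $\{(X,U_X,\xi_X): X\in\Phi(\lambda)\}$, and it is unchanged when all stations and mobiles are dilated by a common factor $c>0$ with the labels kept. (Examples: a fixed constant, an i.i.d. mark $h_Y=\xi_Y$, the indicator that $Y$ is the station nearest to the origin, or that $U_Y$ is not among the $K$ mobiles nearest to the origin.) Let $\alpha>2$. Then for all $\lambda_b>0$ and $a>0$ the random variables $$\sum_{Y\in\Phi(\lambda_b)} h_Y|U_Y|^{-\alpha}\qquad\text{and}\qquad \sum_{Y\in\Phi(a\lambda_b)}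 a^{-\alpha/2}\,h_Y|U_Y|^{-\alpha}$$ have the same distribution. (The two sums converge absolutely with the same probability, and a sum that does not converge absolutely is given the value $0$.) -/

import Mathlib

/-- The Euclidean plane. -/
abbrev Plane : Type := EuclideanSpace ℝ (Fin 2)

/-- The number of indices `n` with `y n ∈ B`, i.e. the number of points (with multiplicity) of the
configuration enumerated by `y` that lie in `B`. -/
noncomputable def pointCount (y : ℕ → Plane) (B : Set Plane) : ℕ∞ :=
  {n | y n ∈ B}.encard

/-- The random points `Y 0, Y 1, …` enumerate a homogeneous Poisson point process in the plane
with density `lam` (expected number of points per unit area). For `lam > 0` such a process is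
almost surely countably infinite, so it can always be enumerated by `ℕ`; since points are counted
with multiplicity, they are almost surely distinct. -/
structure IsHomogeneousPoisson {Ω : Type*} [MeasurableSpace Ω] (P : MeasureTheory.Measure Ω)
    (Y : ℕ → Ω → Plane) (lam : ℝ) : Prop where
  measurable : ∀ n, Measurable (Y n)
  /-- The number of points in a Borel set of finite area is Poisson with mean density × area. -/
  count_law : ∀ B : Set Plane, MeasurableSet B → MeasureTheory.volume B ≠ ⊤ → ∀ k : ℕ,
    P {ω | pointCount (fun n => Y n ω) B = k} =
      ProbabilityTheory.poissonMeasure (lam * (MeasureTheory.volume B).toReal).toNNReal {k}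
  /-- The numbers of points in disjoint Borel sets are independent. -/
  count_indep : ∀ (m : ℕ) (B : Fin m → Set Plane), (∀ i, MeasurableSet (B i)) →
    Pairwise (fun i j => Disjoint (B i) (B j)) →
    ProbabilityTheory.iIndepFun (fun i ω => pointCount (fun n => Y n ω) (B i)) P

/-- The Voronoi cell with nucleus `y n`: the locations at least as close to `y n` as to any other
point of the configuration. -/
def voronoiCell (y : ℕ → Plane) (n : ℕ) : Set Plane :=
  {x | ∀ m, dist x (y n) ≤ dist x (y m)}

/-- Conditionally on the base stations `Y`, the mobiles `U n` are independent and `U n` is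
uniformly distributed in the Voronoi cell with nucleus `Y n`: the conditional probability given
`Y` of `U i ∈ B i` for all `i < N` is `∏ i < N, |V_i ∩ B i| / |V_i|`, where `V_i` is the cell of
`Y i`. -/
def UniformInCells {Ω : Type*} [MeasurableSpace Ω] (P : MeasureTheory.Measure Ω)
    (Y U : ℕ → Ω → Plane) : Prop :=
  ∀ A : Set (ℕ → Plane), MeasurableSet A →
    ∀ (N : ℕ) (B : ℕ → Set Plane), (∀ i, MeasurableSet (B i)) →
      P {ω | (fun n => Y n ω) ∈ A ∧ ∀ i < N, U i ω ∈ B i} =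
        MeasureTheory.lintegral (P.restrict {ω | (fun n => Y n ω) ∈ A}) (fun ω =>
          ∏ i ∈ Finset.range N,
            ProbabilityTheory.cond MeasureTheory.volume (voronoiCell (fun n => Y n ω) i) (B i))

/-- The uplink network of density `lam`: base stations `Y n` forming a homogeneous Poisson process,
the active mobile `U n` served by `Y n`, and a label `ξ n` carried by `Y n`; the labels are i.i.d.
with law `ν` and independent of all locations. -/
structure IsNetwork {Ω E : Type*} [MeasurableSpace Ω] [MeasurableSpace E]
    (P : MeasureTheory.Measure Ω) (ν : MeasureTheory.Measure E) (lam : ℝ)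
    (Y U : ℕ → Ω → Plane) (ξ : ℕ → Ω → E) : Prop where
  poisson : IsHomogeneousPoisson P Y lam
  measurable_mobile : ∀ n, Measurable (U n)
  uniform : UniformInCells P Y U
  measurable_label : ∀ n, Measurable (ξ n)
  label_law : ∀ n, P.map (ξ n) = ν
  label_iid : ProbabilityTheory.iIndepFun ξ P
  label_indep : ProbabilityTheory.IndepFun (fun ω n => ξ n ω) (fun ω n => (Y n ω, U n ω)) P

/-- The station of index `n` with its mobile and its label, as one point. -/
def station {Ω E : Type*} (Y U : ℕ → Ω → Plane) (ξ : ℕ → Ω → E) (n : ℕ) (ω : Ω) :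
    Plane × Plane × E :=
  (Y n ω, U n ω, ξ n ω)

/-- The dilation of the plane by the factor `c` moves stations and mobiles and leaves the label
carried by the station unchanged. -/
def dilate {E : Type*} (c : ℝ) (x : Plane × Plane × E) : Plane × Plane × E :=
  (c • x.1, c • x.2.1, x.2.2)

/-- A rule `H` that gives the station `x` of a network `z` the coefficient `H x z`. The coefficient
belongs to the station itself: it depends neither on the order in which the stations are
enumerated nor on the unit of length. -/
structure IsCoefficientRule {E : Type*} [MeasurableSpace E]
    (H : Plane × Plane × E → (ℕ → Plane × Plane × E) → ℝ) : Prop where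
  measurable : Measurable (Function.uncurry H)
  perm : ∀ (σ : Equiv.Perm ℕ) x z, H x (fun n => z (σ n)) = H x z
  dilation : ∀ c : ℝ, 0 < c → ∀ x z, H (dilate c x) (fun n => dilate c (z n)) = H x z

/-- The coefficient `h_Y` of the station `Y n`. -/
def coeff {Ω E : Type*} (H : Plane × Plane × E → (ℕ → Plane × Plane × E) → ℝ)
    (Y U : ℕ → Ω → Plane) (ξ : ℕ → Ω → E) (n : ℕ) (ω : Ω) : ℝ :=
  H (station Y U ξ n ω) (fun m => station Y U ξ m ω)

/-! Dilating the plane by `√a` turns a network of density `a * lam` into one of density `lam`: areas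
scale by `a`, Voronoi cells dilate with their nuclei, and uniform laws stay uniform
(`IsNetwork.smul`). The coefficients do not change, and `‖√a • u‖ ^ (-α) = a ^ (-(α / 2)) * ‖u‖ ^
(-α)`, so the second sum is, term by term, the unscaled sum of the dilated network.

It remains to see that density and label law determine the law of the sum, although the enumerations
of the two networks are arbitrary. Both are re-enumerated by sorting the stations along a measurable
injection of the plane into `ℝ` with bounded sublevel sets. The sorted stations are a measurable
function of point counts, whose joint law depends on the density only
(`IsHomogeneousPoisson.map_sorted`). Since sorting looks at the stations alone, mobiles and labels
keep their conditional law (`IsNetwork.measure_relabel`), so the sorted networks have equal laws.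
The sum and its summability are invariant under permutation, hence are measurable functions of the
sorted network. -/

open MeasureTheory ProbabilityTheory Set Filter
open scoped ENNReal

/-! ### Measurable sorting of locally finite real sequences -/

/-- The set of indices preceding `n` when the indices are ordered by the value of `x`, ties being
broken by the index itself. -/
def precedingIndices (x : ℕ → ℝ) (n : ℕ) : Set ℕ :=
  {j | x j < x n ∨ x j = x n ∧ j < n}

theorem mem_precedingIndices {x : ℕ → ℝ} {n j : ℕ} :
    j ∈ precedingIndices x n ↔ x j < x n ∨ x j = x n ∧ j < n := Iff.rfl

/-- The position of the index `n` in the increasing enumeration of the sequence `x`. -/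
noncomputable def sortRank (x : ℕ → ℝ) (n : ℕ) : ℕ := (precedingIndices x n).ncard

theorem precedingIndices_ssubset {x : ℕ → ℝ} {m n : ℕ} (h : m ∈ precedingIndices x n) :
    precedingIndices x m ⊂ precedingIndices x n := by
  rw [mem_precedingIndices] at h
  refine ⟨fun j hj => ?_, fun hs => ?_⟩
  · rw [mem_precedingIndices] at hj ⊢
    rcases h with h | ⟨h, h'⟩ <;> rcases hj with hj | ⟨hj, hj'⟩
    · exact Or.inl (hj.trans h)
    · exact Or.inl (hj ▸ h)
    · exact Or.inl (h ▸ hj)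
    · exact Or.inr ⟨hj.trans h, hj'.trans h'⟩
  · have := hs (mem_precedingIndices.2 h)
    rw [mem_precedingIndices] at this
    simp at this

theorem precedingIndices_total (x : ℕ → ℝ) {m n : ℕ} (h : m ≠ n) :
    m ∈ precedingIndices x n ∨ n ∈ precedingIndices x m := by
  simp only [mem_precedingIndices]
  rcases lt_trichotomy (x m) (x n) with h1 | h1 | h1
  · exact Or.inl (Or.inl h1)
  · rcases lt_or_gt_of_ne h with h2 | h2
    · exact Or.inl (Or.inr ⟨h1, h2⟩)
    · exact Or.inr (Or.inr ⟨h1.symm, h2⟩)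
  · exact Or.inr (Or.inl h1)

section LocallyFinite

variable {x : ℕ → ℝ} (hx : ∀ t, {n | x n ≤ t}.Finite)
include hx

theorem finite_precedingIndices (n : ℕ) : (precedingIndices x n).Finite :=
  (hx (x n)).subset fun _ hj => hj.elim le_of_lt fun h => h.1.le

theorem sortRank_lt {m n : ℕ} (h : m ∈ precedingIndices x n) : sortRank x m < sortRank x n :=
  ncard_lt_ncard (precedingIndices_ssubset h) (finite_precedingIndices hx n)

theorem sortRank_injective : Function.Injective (sortRank x) := by
  intro m n h
  by_contra hmn
  rcases precedingIndices_total x hmn with h' | h'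
  · exact (sortRank_lt hx h').ne h
  · exact (sortRank_lt hx h').ne h.symm

/-- The index of largest rank among those preceding `n` is its immediate predecessor: everything
else preceding `n` precedes it too. Thus ranks have no gaps. -/
theorem exists_sortRank_eq_of_succ {n k : ℕ} (h : sortRank x n = k + 1) :
    ∃ m, sortRank x m = k := by
  have hne : (precedingIndices x n).Nonempty := by
    rw [← ncard_pos (finite_precedingIndices hx n)]
    change 0 < sortRank x n
    omega
  obtain ⟨m, hm, hmax⟩ :=
    exists_max_image _ (sortRank x) (finite_precedingIndices hx n) hne
  refine ⟨m, ?_⟩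
  have : precedingIndices x n = insert m (precedingIndices x m) := by
    ext j
    constructor
    · intro hj
      by_cases hjm : j = m
      · exact Or.inl hjm
      · rcases precedingIndices_total x hjm with h' | h'
        · exact Or.inr h'
        · exact absurd (sortRank_lt hx h') (hmax j hj).not_gt
    · rintro (rfl | hj)
      · exact hm
      · exact (precedingIndices_ssubset hm).1 hj
  have hm' : m ∉ precedingIndices x m := by simp [mem_precedingIndices]
  have hc : sortRank x n = sortRank x m + 1 := by
    rw [sortRank, this, ncard_insert_of_notMem hm' (finite_precedingIndices hx m), sortRank]
  omega

theorem sortRank_bijective : Function.Bijective (sortRank x) := by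
  refine ⟨sortRank_injective hx, fun k => ?_⟩
  have hinf : (range (sortRank x)).Infinite := infinite_range_of_injective (sortRank_injective hx)
  obtain ⟨_, ⟨n, rfl⟩, hn⟩ := hinf.exists_gt k
  have down : ∀ d l, (∃ n, sortRank x n = l + d) → ∃ n, sortRank x n = l := by
    intro d
    induction d with
    | zero => exact fun l h => h
    | succ d ih =>
      rintro l ⟨n, hn⟩
      exact ih l (exists_sortRank_eq_of_succ hx (by rw [hn]; rfl))
  exact down (sortRank x n - k) k ⟨n, by omega⟩

end LocallyFinite

open scoped Classical in
/-- The permutation listing the indices in the order of increasing values of `x`, if the sequence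
has such a listing, and the identity otherwise. -/
noncomputable def sortPerm (x : ℕ → ℝ) : Equiv.Perm ℕ :=
  -- The fallback makes this a permutation for every `x`, so sums can be reindexed pointwise, with
  -- no exceptional null set.
  if h : Function.Bijective (sortRank x) then (Equiv.ofBijective _ h).symm else 1

theorem monotone_comp_sortPerm {x : ℕ → ℝ} (hx : ∀ t, {n | x n ≤ t}.Finite) :
    Monotone (x ∘ sortPerm x) := by
  have hb := sortRank_bijective hx
  have hr : ∀ i, sortRank x (sortPerm x i) = i := fun i => by
    rw [sortPerm, dif_pos hb]
    exact Equiv.apply_symm_apply (Equiv.ofBijective _ hb) i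
  intro i j hij
  by_contra h
  have := sortRank_lt hx (m := sortPerm x j) (n := sortPerm x i) (Or.inl (not_le.1 h))
  rw [hr, hr] at this
  omega

theorem measurable_sortRank (n : ℕ) : Measurable fun x : ℕ → ℝ => sortRank x n := by
  refine measurable_ncard.comp (measurable_set_iff.2 fun j => ?_)
  refine measurableSet_setOfPred.1 ?_
  simp only [mem_precedingIndices]
  refine (measurableSet_lt (measurable_pi_apply j) (measurable_pi_apply n)).union ?_
  exact (measurableSet_eq_fun (measurable_pi_apply j) (measurable_pi_apply n)).inter
    (MeasurableSet.const _)

theorem measurable_sortPerm (i : ℕ) : Measurable fun x : ℕ → ℝ => sortPerm x i := by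
  have hS : ∀ n k, MeasurableSet {x : ℕ → ℝ | sortRank x n = k} := fun n k =>
    measurable_sortRank n (measurableSet_singleton k)
  have hb : MeasurableSet {x : ℕ → ℝ | Function.Bijective (sortRank x)} := by
    have : {x : ℕ → ℝ | Function.Bijective (sortRank x)} =
        (⋂ m, ⋂ n, {x | sortRank x m = sortRank x n → m = n}) ∩
          ⋂ k, ⋃ n, {x | sortRank x n = k} := by
      ext x
      simp [Function.Bijective, Function.Injective, Function.Surjective]
    rw [this]
    refine MeasurableSet.inter (.iInter fun m => .iInter fun n => ?_)
      (.iInter fun k => .iUnion fun n => hS n k)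
    exact (measurableSet_eq_fun (measurable_sortRank m) (measurable_sortRank n)).imp
      (MeasurableSet.const _)
  refine measurable_to_countable' fun m => ?_
  have : (fun x : ℕ → ℝ => sortPerm x i) ⁻¹' {m} =
      ({x | Function.Bijective (sortRank x)} ∩ {x | sortRank x m = i}) ∪
        ({x | Function.Bijective (sortRank x)}ᶜ ∩ {_x | i = m}) := by
    ext x
    by_cases h : Function.Bijective (sortRank x)
    · have hs : sortPerm x i = m ↔ sortRank x m = i := by
        rw [sortPerm, dif_pos h, Equiv.symm_apply_eq, eq_comm]
        rfl
      simp [h, hs]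
    · simp [sortPerm, h]
  rw [this]
  exact (hb.inter (hS m i)).union (hb.compl.inter (MeasurableSet.const _))

/-- The sorted sequence is determined by the number of terms up to each rational level. -/
theorem comp_sortPerm_eq_iInf {x : ℕ → ℝ} (hx : ∀ t, {n | x n ≤ t}.Finite) (i : ℕ) :
    (x (sortPerm x i) : EReal) =
      ⨅ q : ℚ, if (i : ℕ∞) < {n | x n ≤ (q : ℝ)}.encard then ((q : ℝ) : EReal) else ⊤ := by
  have hmono := monotone_comp_sortPerm hx
  -- Positions start at `0`, so the term at position `i` is at most `t` exactly when at least `i +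
  -- 1` terms are.
  have key : ∀ t : ℝ, (i : ℕ∞) < {n | x n ≤ t}.encard ↔ x (sortPerm x i) ≤ t := by
    intro t
    have he : {n | x n ≤ t}.encard = {k | x (sortPerm x k) ≤ t}.encard :=
      (encard_preimage_of_bijective (sortPerm x).bijective {n | x n ≤ t}).symm
    rw [he]
    constructor
    · intro h
      by_contra hlt
      refine h.not_ge ((encard_le_encard (t := Iio i) fun k hk => ?_).trans_eq ?_)
      · by_contra hki
        exact hlt ((hmono (not_lt.1 hki)).trans hk)
      · rw [encard_eq_coe_toFinset_card]
        simp
    · intro h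
      have hsub : Iic i ⊆ {k | x (sortPerm x k) ≤ t} := fun k hk => (hmono hk).trans h
      refine lt_of_lt_of_le ?_ (encard_le_encard hsub)
      rw [encard_eq_coe_toFinset_card]
      simp only [toFinset_Iic, Nat.card_Iic]
      exact_mod_cast Nat.lt_succ_self i
  apply le_antisymm
  · refine le_iInf fun q => ?_
    split_ifs with h
    · exact EReal.coe_le_coe_iff.2 ((key q).1 h)
    · exact le_top
  · refine le_of_forall_gt fun c hc => ?_
    obtain ⟨q, hq, hqc⟩ := EReal.exists_rat_btwn_of_lt hc
    refine (iInf_le _ q).trans_lt ?_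
    rw [if_pos ((key q).2 (EReal.coe_le_coe_iff.1 hq.le))]
    exact hqc

/-! ### Point counts and the law of the sorted Poisson process -/

theorem measurable_pointCount {Ω : Type*} [MeasurableSpace Ω] {Y : ℕ → Ω → Plane}
    (hY : ∀ n, Measurable (Y n)) {B : Set Plane} (hB : MeasurableSet B) :
    Measurable fun ω => pointCount (fun n => Y n ω) B :=
  measurable_encard.comp (measurable_set_iff.2 fun n => measurableSet_setOfPred.1 (hY n hB))

section Poisson

variable {Ω Ω' : Type*} [MeasurableSpace Ω] [MeasurableSpace Ω']
  {P : Measure Ω} [IsProbabilityMeasure P] {P' : Measure Ω'} [IsProbabilityMeasure P']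
  {Y : ℕ → Ω → Plane} {Y' : ℕ → Ω' → Plane} {lam : ℝ}

/-- The Poisson masses of the finite values already add up to one. -/
theorem IsHomogeneousPoisson.measure_pointCount_eq_top (h : IsHomogeneousPoisson P Y lam)
    {B : Set Plane} (hB : MeasurableSet B) (hvol : volume B ≠ ⊤) :
    P {ω | pointCount (fun n => Y n ω) B = ⊤} = 0 := by
  have hm := measurable_pointCount h.measurable hB
  have h1 : P (⋃ k : ℕ, {ω | pointCount (fun n => Y n ω) B = k}) = 1 := by
    rw [measure_iUnion]
    · simp_rw [h.count_law B hB hvol]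
      rw [← measure_iUnion, iUnion_of_singleton, measure_univ]
      · exact fun i j hij => by simpa using hij
      · exact fun i => measurableSet_singleton i
    · intro i j hij
      refine Set.disjoint_left.2 fun ω hi hj => hij ?_
      simp only [mem_ofPred_eq] at hi hj
      exact_mod_cast hi.symm.trans hj
    · exact fun k => hm (measurableSet_singleton _)
  have hU : MeasurableSet (⋃ k : ℕ, {ω | pointCount (fun n => Y n ω) B = k}) :=
    .iUnion fun k => hm (measurableSet_singleton _)
  rw [← prob_compl_eq_zero_iff hU] at h1
  refine measure_mono_null (fun ω hω => ?_) h1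
  simp only [mem_ofPred_eq] at hω
  simp [hω]

theorem IsHomogeneousPoisson.map_pointCount (h : IsHomogeneousPoisson P Y lam)
    (h' : IsHomogeneousPoisson P' Y' lam) {B : Set Plane} (hB : MeasurableSet B)
    (hvol : volume B ≠ ⊤) :
    P.map (fun ω => pointCount (fun n => Y n ω) B) =
      P'.map (fun ω => pointCount (fun n => Y' n ω) B) := by
  refine Measure.ext_of_singleton fun k => ?_
  rw [Measure.map_apply (measurable_pointCount h.measurable hB) (measurableSet_singleton k),
    Measure.map_apply (measurable_pointCount h'.measurable hB) (measurableSet_singleton k)]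
  induction k using ENat.recTopCoe with
  | top =>
    exact (h.measure_pointCount_eq_top hB hvol).trans (h'.measure_pointCount_eq_top hB hvol).symm
  | coe k => exact (h.count_law B hB hvol k).trans (h'.count_law B hB hvol k).symm

omit [IsProbabilityMeasure P] in
theorem IsHomogeneousPoisson.iIndepFun_pointCount (h : IsHomogeneousPoisson P Y lam)
    {ι : Type*} [Fintype ι] {B : ι → Set Plane} (hB : ∀ i, MeasurableSet (B i))
    (hd : Pairwise fun i j => Disjoint (B i) (B j)) :
    iIndepFun (fun i ω => pointCount (fun n => Y n ω) (B i)) P := by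
  let e := Fintype.equivFin ι
  have := (h.count_indep (Fintype.card ι) (fun k => B (e.symm k)) (fun k => hB _)
    fun i j hij => hd (e.symm.injective.ne hij)).precomp e.injective
  simpa [Function.comp_def] using this

theorem pointCount_eq_finsum {ι : Type*} {y : ℕ → Plane} [Finite ι] {D : ι → Set Plane}
    (hd : Pairwise fun i j => Disjoint (D i) (D j)) (T : Set ι) :
    pointCount y (⋃ s ∈ T, D s) = ∑ᶠ s ∈ T, pointCount y (D s) := by
  have : {n | y n ∈ ⋃ s ∈ T, D s} = ⋃ s ∈ T, {n | y n ∈ D s} := by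
    ext n
    simp
  rw [pointCount, this]
  refine (Set.toFinite T).encard_biUnion fun i _ j _ hij => ?_
  exact Set.disjoint_left.2 fun n hi hj => Set.disjoint_left.1 (hd hij) hi hj

/-- The joint law of the numbers of points in finitely many sets of finite area is determined by
the density. -/
theorem IsHomogeneousPoisson.map_pointCounts (h : IsHomogeneousPoisson P Y lam)
    (h' : IsHomogeneousPoisson P' Y' lam) {ι : Type*} [Fintype ι] {B : ι → Set Plane}
    (hB : ∀ i, MeasurableSet (B i)) (hvol : ∀ i, volume (B i) ≠ ⊤) :
    P.map (fun ω i => pointCount (fun n => Y n ω) (B i)) =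
      P'.map (fun ω i => pointCount (fun n => Y' n ω) (B i)) := by
  classical
  -- The atoms of the family: `D s` holds the points lying in `B i` for exactly the `i ∈ s`. The
  -- atom outside every `B i` may have infinite area and is replaced by `∅`. Counts in atoms are
  -- independent, and each count in `B i` is a sum of them.
  let D : Finset ι → Set Plane := fun s =>
    if s = ∅ then ∅ else ⋂ i, if i ∈ s then B i else (B i)ᶜ
  have hmem : ∀ s x, x ∈ D s ↔ s ≠ ∅ ∧ ∀ i, i ∈ s ↔ x ∈ B i := by
    intro s x
    by_cases hs : s = ∅
    · simp [D, hs]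
    · simp only [D, if_neg hs, mem_iInter, ne_eq, hs, not_false_eq_true, true_and]
      refine forall_congr' fun i => ?_
      by_cases hi : i ∈ s <;> simp [hi]
  have hDm : ∀ s, MeasurableSet (D s) := by
    intro s
    by_cases hs : s = ∅
    · simp [D, hs]
    · simp only [D, if_neg hs]
      refine .iInter fun i => ?_
      split_ifs
      exacts [hB i, (hB i).compl]
  have hDvol : ∀ s, volume (D s) ≠ ⊤ := by
    intro s
    by_cases hs : s = ∅
    · simp [D, hs]
    · obtain ⟨i, hi⟩ := Finset.nonempty_iff_ne_empty.2 hs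
      exact measure_ne_top_of_subset (fun x hx => (((hmem s x).1 hx).2 i).1 hi) (hvol i)
  have hDd : Pairwise fun s t => Disjoint (D s) (D t) := by
    intro s t hst
    refine Set.disjoint_left.2 fun x hs ht => hst ?_
    ext i
    rw [((hmem s x).1 hs).2 i, ((hmem t x).1 ht).2 i]
  have hBD : ∀ i, B i = ⋃ s ∈ {s : Finset ι | i ∈ s}, D s := by
    intro i
    ext x
    simp only [mem_iUnion, mem_ofPred_eq, exists_prop, hmem]
    constructor
    · intro hx
      refine ⟨Finset.univ.filter fun j => x ∈ B j, by simpa using hx, ?_, by simp⟩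
      exact Finset.nonempty_iff_ne_empty.1 ⟨i, by simpa using hx⟩
    · rintro ⟨s, his, -, hs⟩
      exact (hs i).1 his
  let F : (Finset ι → ℕ∞) → ι → ℕ∞ := fun v i => ∑ᶠ s ∈ {s : Finset ι | i ∈ s}, v s
  have hF : Measurable F := .of_discrete
  have hc : ∀ y : ℕ → Plane, (fun i => pointCount y (B i)) = F fun s => pointCount y (D s) := by
    intro y
    funext i
    rw [hBD i]
    exact pointCount_eq_finsum hDd _
  have hmD := fun s => measurable_pointCount h.measurable (hDm s)
  have hmD' := fun s => measurable_pointCount h'.measurable (hDm s)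
  rw [show (fun ω i => pointCount (fun n => Y n ω) (B i)) =
      F ∘ fun ω s => pointCount (fun n => Y n ω) (D s) from funext fun ω => hc fun n => Y n ω,
    show (fun ω i => pointCount (fun n => Y' n ω) (B i)) =
      F ∘ fun ω s => pointCount (fun n => Y' n ω) (D s) from funext fun ω => hc fun n => Y' n ω,
    ← Measure.map_map hF (measurable_pi_lambda _ hmD),
    ← Measure.map_map hF (measurable_pi_lambda _ hmD'),
    (h.iIndepFun_pointCount hDm hDd).map_fun_eq_pi_map fun s => (hmD s).aemeasurable,
    (h'.iIndepFun_pointCount hDm hDd).map_fun_eq_pi_map fun s => (hmD' s).aemeasurable]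
  exact congrArg (fun μ => (Measure.pi μ).map F) (funext fun s => h.map_pointCount h' (hDm s) (hDvol s))

theorem IsHomogeneousPoisson.map_pointCount_process (h : IsHomogeneousPoisson P Y lam)
    (h' : IsHomogeneousPoisson P' Y' lam) {ι : Type*} {B : ι → Set Plane}
    (hB : ∀ i, MeasurableSet (B i)) (hvol : ∀ i, volume (B i) ≠ ⊤) :
    P.map (fun ω i => pointCount (fun n => Y n ω) (B i)) =
      P'.map (fun ω i => pointCount (fun n => Y' n ω) (B i)) := by
  have hm := measurable_pi_lambda (fun ω i => pointCount (fun n => Y n ω) (B i))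
    fun i => measurable_pointCount h.measurable (hB i)
  have hm' := measurable_pi_lambda (fun ω i => pointCount (fun n => Y' n ω) (B i))
    fun i => measurable_pointCount h'.measurable (hB i)
  refine IsProjectiveLimit.unique
    (P := fun I : Finset ι => P.map fun ω => I.restrict fun i => pointCount (fun n => Y n ω) (B i))
    (isProjectiveLimit_map hm.aemeasurable) ?_
  intro I
  rw [Measure.map_map (Finset.measurable_restrict _) hm']
  exact (h.map_pointCounts h' (B := fun i : I => B i) (fun i => hB i) fun i => hvol i).symm

/-- A measurable injection of the plane into the line whose sublevel sets are bounded. -/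
theorem exists_measurableEmbedding_bounded_sublevel :
    ∃ φ : Plane → ℝ, MeasurableEmbedding φ ∧ ∀ t, ∃ r, {x | φ x ≤ t} ⊆ Metric.closedBall 0 r := by
  let ψ : Plane → ℝ := fun x => Real.sigmoid (embeddingReal Plane x)
  have hψm : Measurable ψ :=
    continuous_sigmoid.measurable.comp (measurable_embeddingReal Plane)
  have hψi : Function.Injective ψ := fun x y hxy =>
    (measurableEmbedding_embeddingReal Plane).injective (Real.sigmoid_strictMono.injective hxy)
  have h0 : ∀ x, 0 < ψ x := fun x => Real.sigmoid_pos _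
  have h1 : ∀ x, ψ x < 1 := fun x => Real.sigmoid_lt_one _
  -- As `ψ` takes values in `(0, 1)`, the floor of this sum recovers `⌊‖x‖⌋` and the remainder
  -- recovers `ψ x`, hence `x`.
  refine ⟨fun x => ⌊‖x‖⌋ + ψ x, Measurable.measurableEmbedding ?_ ?_, fun t => ⟨t + 1, ?_⟩⟩
  · refine Measurable.add ?_ hψm
    exact (measurable_of_countable _).comp (Int.measurable_floor.comp measurable_norm)
  · intro x y hxy
    have hf : ∀ z, ⌊(⌊‖z‖⌋ : ℝ) + ψ z⌋ = ⌊‖z‖⌋ := fun z => by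
      rw [Int.floor_intCast_add, Int.floor_eq_zero_iff.2 ⟨(h0 z).le, h1 z⟩, add_zero]
    have h2 : ⌊‖x‖⌋ = ⌊‖y‖⌋ := by rw [← hf x, ← hf y]; exact congrArg _ hxy
    simp only [h2, add_right_inj] at hxy
    exact hψi hxy
  · intro x hx
    simp only [mem_ofPred_eq] at hx
    rw [mem_closedBall_zero_iff]
    have := Int.lt_floor_add_one ‖x‖
    linarith [h0 x]

theorem IsHomogeneousPoisson.ae_finite_sublevel (h : IsHomogeneousPoisson P Y lam)
    {φ : Plane → ℝ} (hφ : Measurable φ) (hb : ∀ t, ∃ r, {x | φ x ≤ t} ⊆ Metric.closedBall 0 r) :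
    ∀ᵐ ω ∂P, ∀ t, {n | φ (Y n ω) ≤ t}.Finite := by
  have hvol : ∀ k : ℕ, volume {x | φ x ≤ k} ≠ ⊤ := fun k =>
    let ⟨r, hr⟩ := hb k
    measure_ne_top_of_subset hr measure_closedBall_lt_top.ne
  have hk : ∀ᵐ ω ∂P, ∀ k : ℕ, pointCount (fun n => Y n ω) {x | φ x ≤ k} ≠ ⊤ := by
    rw [ae_all_iff]
    intro k
    rw [ae_iff]
    simp only [ne_eq, not_not]
    exact h.measure_pointCount_eq_top (hφ measurableSet_Iic) (hvol k)
  filter_upwards [hk] with ω hω t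
  obtain ⟨k, hk⟩ := exists_nat_ge t
  refine (Set.encard_ne_top_iff.1 (hω k)).subset fun n hn => ?_
  exact le_trans (show φ (Y n ω) ≤ t from hn) hk

/-- The stations listed in the order of increasing values of `φ` have a law that depends on the
density only. -/
theorem IsHomogeneousPoisson.map_sorted (h : IsHomogeneousPoisson P Y lam)
    (h' : IsHomogeneousPoisson P' Y' lam) {φ : Plane → ℝ} (hφ : MeasurableEmbedding φ)
    (hb : ∀ t, ∃ r, {x | φ x ≤ t} ⊆ Metric.closedBall 0 r) :
    P.map (fun ω i => Y (sortPerm (fun n => φ (Y n ω)) i) ω) =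
      P'.map (fun ω i => Y' (sortPerm (fun n => φ (Y' n ω)) i) ω) := by
  -- A measurable left inverse of `φ` recovers the stations from their sorted `φ`-values; `G` reads
  -- those values off the counts at rational levels.
  obtain ⟨g, hg, hgφ⟩ := hφ.exists_measurable_extend measurable_id fun _ => inferInstance
  let G : (ℚ → ℕ∞) → ℕ → Plane := fun v i =>
    g (⨅ q : ℚ, if (i : ℕ∞) < v q then ((q : ℝ) : EReal) else ⊤).toReal
  have hG : Measurable G := by
    refine measurable_pi_lambda _ fun i => hg.comp (Measurable.ereal_toReal ?_)
    refine Measurable.iInf fun q => ?_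
    exact (Measurable.of_discrete (f := fun k : ℕ∞ =>
      if (i : ℕ∞) < k then ((q : ℝ) : EReal) else ⊤)).comp (measurable_pi_apply q)
  have hB : ∀ q : ℚ, MeasurableSet {x | φ x ≤ (q : ℝ)} := fun q => hφ.measurable measurableSet_Iic
  have hvol : ∀ q : ℚ, volume {x | φ x ≤ (q : ℝ)} ≠ ⊤ := fun q =>
    let ⟨r, hr⟩ := hb q
    measure_ne_top_of_subset hr measure_closedBall_lt_top.ne
  have rep : ∀ y : ℕ → Plane, (∀ t, {n | φ (y n) ≤ t}.Finite) →
      (fun i => y (sortPerm (fun n => φ (y n)) i)) =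
        G fun q => pointCount y {x | φ x ≤ (q : ℝ)} := by
    intro y hy
    funext i
    have := comp_sortPerm_eq_iInf hy i
    simp only [G, pointCount, mem_ofPred_eq]
    rw [← this, EReal.toReal_coe]
    exact (congrFun hgφ _).symm
  have e1 : P.map (fun ω i => Y (sortPerm (fun n => φ (Y n ω)) i) ω) =
      P.map (G ∘ fun ω q => pointCount (fun n => Y n ω) {x | φ x ≤ (q : ℝ)}) := by
    refine Measure.map_congr ?_
    filter_upwards [h.ae_finite_sublevel hφ.measurable hb] with ω hω
    exact rep (fun n => Y n ω) hω
  have e2 : P'.map (fun ω i => Y' (sortPerm (fun n => φ (Y' n ω)) i) ω) =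
      P'.map (G ∘ fun ω q => pointCount (fun n => Y' n ω) {x | φ x ≤ (q : ℝ)}) := by
    refine Measure.map_congr ?_
    filter_upwards [h'.ae_finite_sublevel hφ.measurable hb] with ω hω
    exact rep (fun n => Y' n ω) hω
  rw [e1, e2, ← Measure.map_map hG, ← Measure.map_map hG, h.map_pointCount_process h' hB hvol]
  · exact measurable_pi_lambda _ fun q => measurable_pointCount h'.measurable (hB q)
  · exact measurable_pi_lambda _ fun q => measurable_pointCount h.measurable (hB q)

end Poisson

/-! ### Mobiles and labels under a station-dependent relabelling -/

theorem measurable_select {Ω T : Type*} [MeasurableSpace Ω] [MeasurableSpace T] {X : ℕ → Ω → T}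
    (hX : ∀ n, Measurable (X n)) {σ : ℕ → Ω → ℕ} (hσ : ∀ i, Measurable (σ i)) :
    Measurable fun ω i => X (σ i ω) ω := by
  refine measurable_pi_lambda _ fun i => ?_
  have : Measurable fun p : Ω × ℕ => X p.2 p.1 := measurable_from_prod_countable_left hX
  exact this.comp (measurable_id.prodMk (hσ i))

theorem measurable_cond_voronoiCell (i : ℕ) {B : Set Plane} (hB : MeasurableSet B) :
    Measurable fun y : ℕ → Plane => cond volume (voronoiCell y i) B := by
  have hS : MeasurableSet {p : (ℕ → Plane) × Plane | p.2 ∈ voronoiCell p.1 i} := by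
    have : {p : (ℕ → Plane) × Plane | p.2 ∈ voronoiCell p.1 i} =
        ⋂ m, {p | dist p.2 (p.1 i) ≤ dist p.2 (p.1 m)} := by
      ext p
      simp [voronoiCell]
    rw [this]
    exact .iInter fun m => measurableSet_le (by fun_prop) (by fun_prop)
  simp_rw [cond_apply' hB]
  refine Measurable.mul (measurable_measure_prodMk_left hS).inv ?_
  exact measurable_measure_prodMk_left (hS.inter (measurable_snd hB))

theorem voronoiCell_comp_perm (y : ℕ → Plane) (σ : Equiv.Perm ℕ) (i : ℕ) :
    voronoiCell (fun n => y (σ n)) i = voronoiCell y (σ i) := by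
  ext x
  exact σ.forall_congr_left.trans (by simp [voronoiCell])

section Cells

variable {Ω : Type*} [MeasurableSpace Ω] {P : Measure Ω} [IsProbabilityMeasure P]
  {Y U : ℕ → Ω → Plane}

/-- `cond` vanishes on a cell of zero or infinite area and otherwise has mass one. With all test
sets equal to `univ`, a product of masses at most one has integral one, so every factor is almost
surely one. No geometric study of the cells is needed. -/
theorem UniformInCells.ae_cond_univ (h : UniformInCells P Y U) :
    ∀ᵐ ω ∂P, ∀ i, cond volume (voronoiCell (fun n => Y n ω) i) univ = 1 := by
  rw [ae_all_iff]
  intro i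
  have hle : ∀ s : Set Plane, cond volume s univ ≤ 1 := fun s => by
    rw [cond_apply' .univ, inter_univ]
    exact ENNReal.inv_mul_le_one _
  have h1 := h univ .univ (i + 1) (fun _ => univ) fun _ => .univ
  simp only [mem_univ, implies_true, and_self, ofPred_true, measure_univ,
    Measure.restrict_univ] at h1
  have h2 : 1 ≤ ∫⁻ ω, cond volume (voronoiCell (fun n => Y n ω) i) univ ∂P := by
    rw [h1]
    refine lintegral_mono fun ω => ?_
    rw [Finset.prod_range_succ]
    exact mul_le_of_le_one_left' (Finset.prod_le_one' fun _ _ => hle _)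
  refine ae_eq_of_ae_le_of_lintegral_le (g := fun _ => 1) (ae_of_all _ fun ω => hle _) ?_
    aemeasurable_const (by simpa using h2)
  refine ((lintegral_mono fun ω => hle _).trans_lt (b := ∫⁻ _, 1 ∂P) ?_).ne
  simp

/-- Passes from initial segments of indices to arbitrary distinct ones: the other mobiles are left
free, and their factors are almost surely one. -/
theorem UniformInCells.measure_injective (h : UniformInCells P Y U) {A : Set (ℕ → Plane)}
    (hA : MeasurableSet A) {N : ℕ} {m : Fin N → ℕ} (hm : Function.Injective m)
    {B : Fin N → Set Plane} (hB : ∀ i, MeasurableSet (B i)) :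
    P {ω | (fun n => Y n ω) ∈ A ∧ ∀ i, U (m i) ω ∈ B i} =
      ∫⁻ ω in {ω | (fun n => Y n ω) ∈ A},
        ∏ i, cond volume (voronoiCell (fun n => Y n ω) (m i)) (B i) ∂P := by
  classical
  let B' : ℕ → Set Plane := fun j => ⋂ i, if m i = j then B i else univ
  have hB' : ∀ j, MeasurableSet (B' j) := fun j => .iInter fun i => by
    split_ifs
    exacts [hB i, .univ]
  have hBm : ∀ i, B' (m i) = B i := by
    intro i
    ext x
    simp only [B', mem_iInter, hm.eq_iff]
    refine ⟨fun hx => by simpa using hx i, fun hx k => ?_⟩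
    split_ifs with hk
    · exact hk ▸ hx
    · trivial
  have hBn : ∀ j, (∀ i, m i ≠ j) → B' j = univ := fun j hj => by simp [B', hj]
  obtain ⟨M, hM⟩ : ∃ M, ∀ i, m i < M :=
    ⟨Finset.univ.sup m + 1, fun i => Nat.lt_succ_of_le (Finset.le_sup (Finset.mem_univ i))⟩
  have hset : {ω | (fun n => Y n ω) ∈ A ∧ ∀ i, U (m i) ω ∈ B i} =
      {ω | (fun n => Y n ω) ∈ A ∧ ∀ j < M, U j ω ∈ B' j} := by
    ext ω
    refine and_congr_right fun _ => ⟨fun hω j _ => ?_, fun hω i => hBm i ▸ hω (m i) (hM i)⟩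
    by_cases hj : ∃ i, m i = j
    · obtain ⟨i, rfl⟩ := hj
      exact (hBm i).symm ▸ hω i
    · rw [hBn j (not_exists.1 hj)]
      trivial
  rw [hset, h A hA M B' hB']
  refine lintegral_congr_ae (ae_restrict_of_ae ?_)
  filter_upwards [h.ae_cond_univ] with ω hω
  rw [← Finset.prod_subset (s₁ := Finset.univ.image m), Finset.prod_image hm.injOn]
  · simp_rw [hBm]
  · intro j hj
    obtain ⟨i, -, rfl⟩ := Finset.mem_image.1 hj
    exact Finset.mem_range.2 (hM i)
  · intro j _ hj
    rw [hBn j fun i hi => hj (Finset.mem_image.2 ⟨i, Finset.mem_univ i, hi⟩), hω j]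

end Cells

section Network

variable {Ω E : Type*} [MeasurableSpace Ω] [MeasurableSpace E] {P : Measure Ω}
  [IsProbabilityMeasure P] {ν : Measure E} {lam : ℝ} {Y U : ℕ → Ω → Plane} {ξ : ℕ → Ω → E}

theorem IsNetwork.measure_injective (h : IsNetwork P ν lam Y U ξ) {A : Set (ℕ → Plane)}
    (hA : MeasurableSet A) {N : ℕ} {m : Fin N → ℕ} (hm : Function.Injective m)
    {B : Fin N → Set Plane} (hB : ∀ i, MeasurableSet (B i))
    {C : Fin N → Set E} (hC : ∀ i, MeasurableSet (C i)) :
    P {ω | (fun n => Y n ω) ∈ A ∧ ∀ i, U (m i) ω ∈ B i ∧ ξ (m i) ω ∈ C i} =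
      (∏ i, ν (C i)) * ∫⁻ ω in {ω | (fun n => Y n ω) ∈ A},
        ∏ i, cond volume (voronoiCell (fun n => Y n ω) (m i)) (B i) ∂P := by
  have hS : MeasurableSet {e : ℕ → E | ∀ i, e (m i) ∈ C i} := by
    rw [ofPred_forall]
    exact .iInter fun i => measurable_pi_apply (m i) (hC i)
  have hT : MeasurableSet {z : ℕ → Plane × Plane |
      (fun n => (z n).1) ∈ A ∧ ∀ i, (z (m i)).2 ∈ B i} := by
    rw [ofPred_and, ofPred_forall]
    refine MeasurableSet.inter ?_ (.iInter fun i => ?_)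
    · exact (show Measurable fun (z : ℕ → Plane × Plane) n => (z n).1 by fun_prop) hA
    · exact (show Measurable fun z : ℕ → Plane × Plane => (z (m i)).2 by fun_prop) (hB i)
  have hind := h.label_indep.measure_inter_preimage_eq_mul _ _ hS hT
  have hlab : P {ω | ∀ i, ξ (m i) ω ∈ C i} = ∏ i, ν (C i) := by
    have := (h.label_iid.precomp hm).measure_inter_preimage_eq_mul Finset.univ (sets := C)
      fun i _ => hC i
    simp only [Finset.mem_univ, iInter_true] at this
    rw [ofPred_forall]
    refine this.trans (Finset.prod_congr rfl fun i _ => ?_)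
    rw [← h.label_law (m i), Measure.map_apply (h.measurable_label _) (hC i)]
  rw [← h.uniform.measure_injective hA hm hB, ← hlab]
  refine Eq.trans (congrArg P ?_) hind
  ext ω
  simp only [mem_ofPred_eq, mem_inter_iff, mem_preimage, forall_and]
  tauto

/-- The law of a network whose stations are relabelled by a measurable rule `s`, in terms of the
law of the relabelled stations. -/
theorem IsNetwork.measure_relabel (h : IsNetwork P ν lam Y U ξ)
    {s : (ℕ → Plane) → Equiv.Perm ℕ} (hs : ∀ i, Measurable fun y => s y i)
    {A : Set (ℕ → Plane)} (hA : MeasurableSet A) {N : ℕ}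
    {B : Fin N → Set Plane} (hB : ∀ i, MeasurableSet (B i))
    {C : Fin N → Set E} (hC : ∀ i, MeasurableSet (C i)) :
    P {ω | (fun i => Y (s (fun n => Y n ω) i) ω) ∈ A ∧
        ∀ i : Fin N, U (s (fun n => Y n ω) i) ω ∈ B i ∧ ξ (s (fun n => Y n ω) i) ω ∈ C i} =
      (∏ i, ν (C i)) * ∫⁻ y in A, ∏ i : Fin N, cond volume (voronoiCell y i) (B i)
        ∂(P.map fun ω i => Y (s (fun n => Y n ω) i) ω) := by
  have hYm : Measurable fun ω n => Y n ω := measurable_pi_lambda _ h.poisson.measurable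
  have hsort : Measurable fun (y : ℕ → Plane) i => y (s y i) :=
    measurable_select measurable_pi_apply hs
  have hYs : Measurable fun ω i => Y (s (fun n => Y n ω) i) ω := hsort.comp hYm
  -- The random indices are frozen by splitting over the countably many values `m` of the first `N`
  -- of them. On each piece the indices are deterministic, and the piece is an event about the
  -- stations alone.
  let D : (Fin N → ℕ) → Set (ℕ → Plane) := fun m =>
    {y | (fun i => y (s y i)) ∈ A ∧ ∀ i : Fin N, s y i = m i}
  have hD : ∀ m, MeasurableSet (D m) := fun m => by
    simp only [D, ofPred_and, ofPred_forall]
    exact (hsort hA).inter (.iInter fun i => hs i (measurableSet_singleton _))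
  have hDd : ∀ m m' y, y ∈ D m → y ∈ D m' → m = m' := fun m m' y hy hy' =>
    funext fun i => (hy.2 i).symm.trans (hy'.2 i)
  have hinj : ∀ m y, y ∈ D m → Function.Injective m := fun m y hy i j hij => by
    rw [← hy.2, ← hy.2] at hij
    exact Fin.ext ((s y).injective hij)
  let V : (Fin N → ℕ) → Set Ω := fun m =>
    {ω | (fun n => Y n ω) ∈ D m ∧ ∀ i, U (m i) ω ∈ B i ∧ ξ (m i) ω ∈ C i}
  let W : (Fin N → ℕ) → Set Ω := fun m => {ω | (fun n => Y n ω) ∈ D m}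
  have hV : ∀ m, MeasurableSet (V m) := fun m => by
    simp only [V, ofPred_and, ofPred_forall]
    exact (hYm (hD m)).inter (.iInter fun i =>
      (h.measurable_mobile _ (hB i)).inter (h.measurable_label _ (hC i)))
  have hW : ∀ m, MeasurableSet (W m) := fun m => hYm (hD m)
  have hWd : Pairwise (Function.onFun Disjoint W) := fun m m' hmm =>
    Set.disjoint_left.2 fun ω hω hω' =>
      hmm (hDd m m' (fun n => Y n ω) hω hω')
  have hVd : Pairwise (Function.onFun Disjoint V) := fun m m' hmm =>
    (hWd hmm).mono (fun ω hω => hω.1) fun ω hω => hω.1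
  have hcov : {ω | (fun i => Y (s (fun n => Y n ω) i) ω) ∈ A ∧
      ∀ i : Fin N, U (s (fun n => Y n ω) i) ω ∈ B i ∧ ξ (s (fun n => Y n ω) i) ω ∈ C i} =
      ⋃ m, V m := by
    ext ω
    simp only [mem_iUnion]
    constructor
    · rintro ⟨h1, h2⟩
      exact ⟨fun i => s (fun n => Y n ω) i, ⟨h1, fun _ => rfl⟩, h2⟩
    · rintro ⟨m, ⟨h1, h2⟩, h3⟩
      refine ⟨h1, fun i => ?_⟩
      rw [h2 i]
      exact h3 i
  have hWcov : (fun ω i => Y (s (fun n => Y n ω) i) ω) ⁻¹' A = ⋃ m, W m := by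
    ext ω
    simp only [mem_iUnion]
    constructor
    · intro h1
      exact ⟨fun i => s (fun n => Y n ω) i, h1, fun _ => rfl⟩
    · rintro ⟨m, h1, -⟩
      exact h1
  have hg : Measurable fun y : ℕ → Plane =>
      ∏ i : Fin N, cond volume (voronoiCell y i) (B i) :=
    Finset.measurable_fun_prod _ fun i _ => measurable_cond_voronoiCell i (hB i)
  rw [hcov, measure_iUnion hVd hV, setLIntegral_map hA hg hYs, hWcov,
    lintegral_iUnion hW hWd, ← ENNReal.tsum_mul_left]
  refine tsum_congr fun m => ?_
  by_cases hm : Function.Injective m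
  · rw [h.measure_injective (hD m) hm hB hC]
    congr 1
    refine setLIntegral_congr_fun (hW m) fun ω hω => Finset.prod_congr rfl fun i _ => ?_
    rw [voronoiCell_comp_perm (fun n => Y n ω), hω.2 i]
  · have hDm : D m = ∅ := eq_empty_of_forall_notMem fun y hy => hm (hinj m y hy)
    simp [V, W, hDm]

end Network

/-! ### Equality of laws of sorted networks -/

theorem isCountablySpanning_squareCylinders {T : Type*} [MeasurableSpace T] :
    IsCountablySpanning (squareCylinders fun _ : ℕ => {s : Set T | MeasurableSet s}) :=
  ⟨fun _ => univ, fun _ => ⟨∅, fun _ => univ, fun _ _ => .univ, by simp⟩, iUnion_const _⟩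

theorem isPiSystem_measurable_squareCylinders {T : Type*} [MeasurableSpace T] :
    IsPiSystem (squareCylinders fun _ : ℕ => {s : Set T | MeasurableSet s}) :=
  isPiSystem_squareCylinders (fun _ => MeasurableSpace.isPiSystem_measurableSet) fun _ => .univ

/-- Finite measures on a product of a space with two sequence spaces agree if they agree on the
boxes restricting finitely many terms. -/
theorem Measure.ext_of_boxes {X V W : Type*} [MeasurableSpace X] [MeasurableSpace V]
    [MeasurableSpace W] {μ μ' : Measure (X × (ℕ → V) × (ℕ → W))} [IsFiniteMeasure μ]
    (h : ∀ A : Set X, MeasurableSet A → ∀ (N : ℕ) (B : Fin N → Set V) (C : Fin N → Set W),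
      (∀ i, MeasurableSet (B i)) → (∀ i, MeasurableSet (C i)) →
      μ {z | z.1 ∈ A ∧ ∀ i : Fin N, z.2.1 i ∈ B i ∧ z.2.2 i ∈ C i} =
        μ' {z | z.1 ∈ A ∧ ∀ i : Fin N, z.2.1 i ∈ B i ∧ z.2.2 i ∈ C i}) : μ = μ' := by
  classical
  let QV : Set (Set (ℕ → V)) := squareCylinders fun _ => {s | MeasurableSet s}
  let QW : Set (Set (ℕ → W)) := squareCylinders fun _ => {s | MeasurableSet s}
  have hspan2 : IsCountablySpanning (image2 (· ×ˢ ·) QV QW) :=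
    isCountablySpanning_squareCylinders.prod isCountablySpanning_squareCylinders
  refine ext_of_generate_finite
    (image2 (· ×ˢ ·) {s : Set X | MeasurableSet s} (image2 (· ×ˢ ·) QV QW)) ?_ ?_ ?_ ?_
  · refine (generateFrom_eq_prod MeasurableSpace.generateFrom_measurableSet ?_
      isCountablySpanning_measurableSet hspan2).symm
    exact generateFrom_eq_prod generateFrom_squareCylinders generateFrom_squareCylinders
      isCountablySpanning_squareCylinders isCountablySpanning_squareCylinders
  · exact MeasurableSpace.isPiSystem_measurableSet.prod (isPiSystem_measurable_squareCylinders.prod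
      isPiSystem_measurable_squareCylinders)
  · rintro _ ⟨A, hA, _, ⟨_, ⟨I, B, hB, rfl⟩, _, ⟨J, C, hC, rfl⟩, rfl⟩, rfl⟩
    -- The two cylinders may restrict different coordinates; both are padded with `univ` up to a
    -- common length.
    obtain ⟨N, hN⟩ := (I ∪ J).exists_nat_subset_range
    have := h A hA N (fun i => if (i : ℕ) ∈ I then B i else univ)
      (fun i => if (i : ℕ) ∈ J then C i else univ)
      (fun i => by split_ifs; exacts [hB i trivial, .univ])
      (fun i => by split_ifs; exacts [hC i trivial, .univ])
    convert this using 2 <;>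
    · ext z
      simp only [mem_prod, Set.mem_pi, Finset.mem_coe, mem_ofPred_eq, forall_and]
      refine and_congr_right fun _ => and_congr ?_ ?_
      · refine ⟨fun hz i => ?_, fun hz i hi => ?_⟩
        · split_ifs with hi
          exacts [hz i hi, trivial]
        · have hiN := Finset.mem_range.1 (hN (Finset.mem_union_left _ hi))
          have := hz ⟨i, hiN⟩
          rwa [if_pos hi] at this
      · refine ⟨fun hz i => ?_, fun hz i hi => ?_⟩
        · split_ifs with hi
          exacts [hz i hi, trivial]
        · have hiN := Finset.mem_range.1 (hN (Finset.mem_union_right _ hi))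
          have := hz ⟨i, hiN⟩
          rwa [if_pos hi] at this
  · simpa using h univ .univ 0 (fun _ => univ) (fun _ => univ) (fun _ => .univ) fun _ => .univ

section Relabel

variable {Ω Ω' E : Type*} [MeasurableSpace Ω] [MeasurableSpace Ω'] [MeasurableSpace E]
  {P : Measure Ω} [IsProbabilityMeasure P] {P' : Measure Ω'} [IsProbabilityMeasure P']
  {ν : Measure E} {lam : ℝ} {Y U : ℕ → Ω → Plane} {ξ : ℕ → Ω → E}
  {Y' U' : ℕ → Ω' → Plane} {ξ' : ℕ → Ω' → E}

/-- The stations, the mobiles and the labels, relabelled by a rule `s` looking at the stations. -/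
def relabel {Ω E : Type*} (s : (ℕ → Plane) → Equiv.Perm ℕ) (Y U : ℕ → Ω → Plane) (ξ : ℕ → Ω → E)
    (ω : Ω) : (ℕ → Plane) × (ℕ → Plane) × (ℕ → E) :=
  (fun i => Y (s (fun n => Y n ω) i) ω, fun i => U (s (fun n => Y n ω) i) ω,
    fun i => ξ (s (fun n => Y n ω) i) ω)

omit [IsProbabilityMeasure P] in
theorem IsNetwork.measurable_relabel (h : IsNetwork P ν lam Y U ξ)
    {s : (ℕ → Plane) → Equiv.Perm ℕ} (hs : ∀ i, Measurable fun y => s y i) :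
    Measurable (relabel s Y U ξ) := by
  have hYm : Measurable fun ω n => Y n ω := measurable_pi_lambda _ h.poisson.measurable
  have hσ := fun i => (hs i).comp hYm
  exact (measurable_select h.poisson.measurable hσ).prodMk
    ((measurable_select h.measurable_mobile hσ).prodMk (measurable_select h.measurable_label hσ))

/-- Two networks of the same density have the same law after a suitable relabelling. -/
theorem IsNetwork.exists_identDistrib_relabel (h : IsNetwork P ν lam Y U ξ)
    (h' : IsNetwork P' ν lam Y' U' ξ') :
    ∃ s : (ℕ → Plane) → Equiv.Perm ℕ,
      IdentDistrib (relabel s Y U ξ) (relabel s Y' U' ξ') P P' := by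
  obtain ⟨φ, hφ, hb⟩ := exists_measurableEmbedding_bounded_sublevel
  let s : (ℕ → Plane) → Equiv.Perm ℕ := fun y => sortPerm fun n => φ (y n)
  have hs : ∀ i, Measurable fun y => s y i := fun i =>
    (measurable_sortPerm i).comp (measurable_pi_lambda _ fun n =>
      hφ.measurable.comp (measurable_pi_apply n))
  have hm := h.measurable_relabel hs
  have hm' := h'.measurable_relabel hs
  refine ⟨s, hm.aemeasurable, hm'.aemeasurable, ?_⟩
  have := Measure.isProbabilityMeasure_map (μ := P) hm.aemeasurable
  refine Measure.ext_of_boxes fun A hA N B C hB hC => ?_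
  have hS : MeasurableSet {z : (ℕ → Plane) × (ℕ → Plane) × (ℕ → E) |
      z.1 ∈ A ∧ ∀ i : Fin N, z.2.1 i ∈ B i ∧ z.2.2 i ∈ C i} := by
    rw [ofPred_and, ofPred_forall]
    refine (measurable_fst hA).inter (.iInter fun i => MeasurableSet.inter ?_ ?_)
    · exact (show Measurable fun z : (ℕ → Plane) × (ℕ → Plane) × (ℕ → E) => z.2.1 i by
        fun_prop) (hB i)
    · exact (show Measurable fun z : (ℕ → Plane) × (ℕ → Plane) × (ℕ → E) => z.2.2 i by
        fun_prop) (hC i)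
  rw [Measure.map_apply hm hS, Measure.map_apply hm' hS]
  refine (h.measure_relabel hs hA hB hC).trans (Eq.trans ?_ (h'.measure_relabel hs hA hB hC).symm)
  -- The box probabilities involve each network only through `ν` and the law of its sorted stations.
  rw [h.poisson.map_sorted h'.poisson hφ hb]

end Relabel

/-! ### Dilation of networks -/

section Dilation

theorem volume_preimage_smul_plane {c : ℝ} (hc : 0 < c) (B : Set Plane) :
    volume ((fun x : Plane => c • x) ⁻¹' B) = ENNReal.ofReal (c ^ 2)⁻¹ * volume B := by
  have := Measure.addHaar_preimage_smul (volume : Measure Plane) hc.ne' B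
  rwa [finrank_euclideanSpace_fin, abs_of_pos (by positivity)] at this

theorem preimage_voronoiCell_smul {c : ℝ} (hc : 0 < c) (y : ℕ → Plane) (i : ℕ) :
    (fun x : Plane => c • x) ⁻¹' voronoiCell (fun n => c • y n) i = voronoiCell y i := by
  ext x
  simp [voronoiCell, dist_smul₀, abs_of_pos hc, hc]

/-- A ratio of areas: numerator and denominator scale by the same factor, finite and nonzero. -/
theorem cond_voronoiCell_smul {c : ℝ} (hc : 0 < c) (y : ℕ → Plane) (i : ℕ) {B : Set Plane}
    (hB : MeasurableSet B) :
    cond volume (voronoiCell y i) ((fun x : Plane => c • x) ⁻¹' B) =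
      cond volume (voronoiCell (fun n => c • y n) i) B := by
  have hk : ENNReal.ofReal (c ^ 2)⁻¹ ≠ 0 := by
    rw [ne_eq, ENNReal.ofReal_eq_zero, not_le]
    positivity
  rw [cond_apply' (measurable_const_smul c hB), cond_apply' hB,
    ← preimage_voronoiCell_smul hc y i, ← preimage_inter, volume_preimage_smul_plane hc,
    volume_preimage_smul_plane hc, ENNReal.mul_inv (.inl hk) (.inl ENNReal.ofReal_ne_top),
    mul_mul_mul_comm, ENNReal.inv_mul_cancel hk ENNReal.ofReal_ne_top, one_mul]

variable {Ω E : Type*} [MeasurableSpace Ω] [MeasurableSpace E] {P : Measure Ω}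
  {ν : Measure E} {lam c : ℝ} {Y U : ℕ → Ω → Plane} {ξ : ℕ → Ω → E}

/-- Dilated points fall in `B` when the original ones fall in its preimage, whose area is smaller by
the factor `c ^ 2` that the density gains. -/
theorem IsHomogeneousPoisson.smul (hc : 0 < c) (h : IsHomogeneousPoisson P Y (c ^ 2 * lam)) :
    IsHomogeneousPoisson P (fun n ω => c • Y n ω) lam where
  measurable n := (h.measurable n).const_smul c
  count_law B hB hvol k := by
    have hv := volume_preimage_smul_plane hc B
    have := h.count_law _ (measurable_const_smul c hB)
      (by rw [hv]; exact ENNReal.mul_ne_top ENNReal.ofReal_ne_top hvol) k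
    rw [hv, ENNReal.toReal_mul, ENNReal.toReal_ofReal (by positivity)] at this
    have he : c ^ 2 * lam * ((c ^ 2)⁻¹ * (volume B).toReal) = lam * (volume B).toReal := by
      field_simp
    rw [he] at this
    exact this
  count_indep m B hB hd :=
    h.count_indep m (fun i => (fun x : Plane => c • x) ⁻¹' B i)
      (fun i => measurable_const_smul c (hB i)) fun i j hij => (hd hij).preimage _

theorem UniformInCells.smul (hc : 0 < c) (h : UniformInCells P Y U) :
    UniformInCells P (fun n ω => c • Y n ω) fun n ω => c • U n ω := by
  intro A hA N B hB
  have hm : Measurable fun (y : ℕ → Plane) n => c • y n := by fun_prop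
  refine (h _ (hm hA) N (fun i => (fun x : Plane => c • x) ⁻¹' B i)
    fun i => measurable_const_smul c (hB i)).trans ?_
  exact lintegral_congr fun ω => Finset.prod_congr rfl fun i _ =>
    cond_voronoiCell_smul hc (fun n => Y n ω) i (hB i)

theorem IsNetwork.smul (hc : 0 < c) (h : IsNetwork P ν (c ^ 2 * lam) Y U ξ) :
    IsNetwork P ν lam (fun n ω => c • Y n ω) (fun n ω => c • U n ω) ξ where
  poisson := h.poisson.smul hc
  measurable_mobile n := (h.measurable_mobile n).const_smul c
  uniform := h.uniform.smul hc
  measurable_label := h.measurable_label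
  label_law := h.label_law
  label_iid := h.label_iid
  label_indep := by
    have hm : Measurable fun (z : ℕ → Plane × Plane) n => (c • (z n).1, c • (z n).2) := by
      fun_prop
    exact h.label_indep.comp measurable_id hm

end Dilation

/-! ### The weighted sum as a function of the sorted network -/

section Interference

variable {Ω Ω' E : Type*} [MeasurableSpace Ω] [MeasurableSpace Ω'] [MeasurableSpace E]
  {H : Plane × Plane × E → (ℕ → Plane × Plane × E) → ℝ}

/-- The contribution of the station of index `n` to the weighted sum. -/
noncomputable def contribution {E : Type*} (H : Plane × Plane × E → (ℕ → Plane × Plane × E) → ℝ)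
    (α : ℝ) (n : ℕ) (z : (ℕ → Plane) × (ℕ → Plane) × (ℕ → E)) : ℝ :=
  H (z.1 n, z.2.1 n, z.2.2 n) (fun m => (z.1 m, z.2.1 m, z.2.2 m)) * ‖z.2.1 n‖ ^ (-α)

theorem IsCoefficientRule.measurable_contribution (hH : IsCoefficientRule H) (α : ℝ) (n : ℕ) :
    Measurable (contribution H α n) := by
  have hg : Measurable fun z : (ℕ → Plane) × (ℕ → Plane) × (ℕ → E) =>
      ((z.1 n, z.2.1 n, z.2.2 n), fun m => (z.1 m, z.2.1 m, z.2.2 m)) := by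
    fun_prop
  exact (hH.measurable.comp hg).mul
    ((show Measurable fun z : (ℕ → Plane) × (ℕ → Plane) × (ℕ → E) => ‖z.2.1 n‖ by
      fun_prop).pow_const (-α))

omit [MeasurableSpace Ω] in
-- The rule ignores the enumeration, so relabelling only permutes the terms of the series.
theorem IsCoefficientRule.contribution_relabel (hH : IsCoefficientRule H) (α : ℝ)
    (s : (ℕ → Plane) → Equiv.Perm ℕ) (Y U : ℕ → Ω → Plane) (ξ : ℕ → Ω → E) (n : ℕ) (ω : Ω) :
    contribution H α n (relabel s Y U ξ ω) =
      coeff H Y U ξ (s (fun n => Y n ω) n) ω * ‖U (s (fun n => Y n ω) n) ω‖ ^ (-α) :=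
  congrArg (· * _) (hH.perm (s fun n => Y n ω) _ fun m => station Y U ξ m ω)

omit [MeasurableSpace Ω] in
theorem IsCoefficientRule.summable_relabel (hH : IsCoefficientRule H) (α : ℝ)
    (s : (ℕ → Plane) → Equiv.Perm ℕ) (Y U : ℕ → Ω → Plane) (ξ : ℕ → Ω → E) (ω : Ω) :
    (Summable fun n => contribution H α n (relabel s Y U ξ ω)) ↔
      Summable fun n => coeff H Y U ξ n ω * ‖U n ω‖ ^ (-α) := by
  simp_rw [hH.contribution_relabel]
  exact (s fun n => Y n ω).summable_iff (f := fun n => coeff H Y U ξ n ω * ‖U n ω‖ ^ (-α))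

omit [MeasurableSpace Ω] in
theorem IsCoefficientRule.tsum_relabel (hH : IsCoefficientRule H) (α : ℝ)
    (s : (ℕ → Plane) → Equiv.Perm ℕ) (Y U : ℕ → Ω → Plane) (ξ : ℕ → Ω → E) (ω : Ω) :
    ∑' n, contribution H α n (relabel s Y U ξ ω) =
      ∑' n, coeff H Y U ξ n ω * ‖U n ω‖ ^ (-α) := by
  simp_rw [hH.contribution_relabel]
  exact (s fun n => Y n ω).tsum_eq fun n => coeff H Y U ξ n ω * ‖U n ω‖ ^ (-α)

/-- Networks of the same density have the same probability of summability and the same law of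
the weighted sum. -/
theorem IsCoefficientRule.identDistrib_tsum (hH : IsCoefficientRule H) (α : ℝ)
    {P : Measure Ω} [IsProbabilityMeasure P] {P' : Measure Ω'} [IsProbabilityMeasure P']
    {ν : Measure E} {lam : ℝ} {Y U : ℕ → Ω → Plane} {ξ : ℕ → Ω → E}
    {Y' U' : ℕ → Ω' → Plane} {ξ' : ℕ → Ω' → E}
    (h : IsNetwork P ν lam Y U ξ) (h' : IsNetwork P' ν lam Y' U' ξ') :
    P {ω | Summable fun n => coeff H Y U ξ n ω * ‖U n ω‖ ^ (-α)} =
        P' {ω | Summable fun n => coeff H Y' U' ξ' n ω * ‖U' n ω‖ ^ (-α)} ∧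
      IdentDistrib (fun ω => ∑' n, coeff H Y U ξ n ω * ‖U n ω‖ ^ (-α))
        (fun ω => ∑' n, coeff H Y' U' ξ' n ω * ‖U' n ω‖ ^ (-α)) P P' := by
  obtain ⟨s, hs⟩ := h.exists_identDistrib_relabel h'
  have hm := hH.measurable_contribution α
  have hsummable : MeasurableSet {z : (ℕ → Plane) × (ℕ → Plane) × (ℕ → E) |
      Summable fun n => contribution H α n z} :=
    -- Summability is convergence of measurable partial sums along the countably generated filter of
    -- finite sets of indices.
    measurableSet_exists_tendsto (by fun_prop)
  have htsum : Measurable fun z => ∑' n, contribution H α n z := Measurable.tsum hm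
  have e := hs.measure_mem_eq hsummable
  have d := hs.comp htsum
  simp only [preimage_ofPred_eq, Function.comp_def, hH.summable_relabel, hH.tsum_relabel] at e d
  exact ⟨e, d⟩

end Interference

theorem lemma1 {Ω Ω' E : Type*} [MeasurableSpace Ω] [MeasurableSpace Ω'] [MeasurableSpace E]
    (P : MeasureTheory.Measure Ω) [MeasureTheory.IsProbabilityMeasure P]
    (P' : MeasureTheory.Measure Ω') [MeasureTheory.IsProbabilityMeasure P']
    (ν : MeasureTheory.Measure E)
    (H : Plane × Plane × E → (ℕ → Plane × Plane × E) → ℝ) (hH : IsCoefficientRule H)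
    (α : ℝ) (hα : 2 < α) (lam : ℝ) (hlam : 0 < lam) (a : ℝ) (ha : 0 < a)
    (Y U : ℕ → Ω → Plane) (ξ : ℕ → Ω → E) (hN : IsNetwork P ν lam Y U ξ)
    (Y' U' : ℕ → Ω' → Plane) (ξ' : ℕ → Ω' → E) (hN' : IsNetwork P' ν (a * lam) Y' U' ξ') :
    P {ω | Summable fun n => coeff H Y U ξ n ω * ‖U n ω‖ ^ (-α)} =
        P' {ω | Summable fun n => a ^ (-(α / 2)) * coeff H Y' U' ξ' n ω * ‖U' n ω‖ ^ (-α)} ∧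
      ProbabilityTheory.IdentDistrib
        (fun ω => ∑' n, coeff H Y U ξ n ω * ‖U n ω‖ ^ (-α))
        (fun ω => ∑' n, a ^ (-(α / 2)) * coeff H Y' U' ξ' n ω * ‖U' n ω‖ ^ (-α)) P P' := by
  -- The dilation factor `√a` is forced by `c ^ 2 = a`, which brings the density `a * lam` to `lam`.
  have hc : 0 < √a := Real.sqrt_pos.2 ha
  rw [← Real.sq_sqrt ha.le] at hN'
  have key : ∀ n ω, a ^ (-(α / 2)) * coeff H Y' U' ξ' n ω * ‖U' n ω‖ ^ (-α) =
      coeff H (fun n ω => √a • Y' n ω) (fun n ω => √a • U' n ω) ξ' n ω * ‖√a • U' n ω‖ ^ (-α) := by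
    intro n ω
    have hcoeff : coeff H (fun n ω => √a • Y' n ω) (fun n ω => √a • U' n ω) ξ' n ω =
        coeff H Y' U' ξ' n ω :=
      hH.dilation _ hc (station Y' U' ξ' n ω) fun m => station Y' U' ξ' m ω
    rw [hcoeff, norm_smul, Real.norm_of_nonneg hc.le, Real.mul_rpow hc.le (norm_nonneg _),
      Real.sqrt_eq_rpow, ← Real.rpow_mul ha.le, show 1 / 2 * -α = -(α / 2) by ring]
    ring
  simp_rw [key]
  exact hH.identDistrib_tsum α hN (hN'.smul hc)
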